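/- A matroid $M$ on a finite set $E$ is \emph{regular} if it is the column matroid over $\mathbb{R}$ of a totally unimodular $r\times|E|$ integer matrix $A$ of rank $r$ (for some $r\ge 0$), with columns labelled by $E$; such an $A$ is called a totally unimodular representation of $M$. The lattice of integer cuts of $M$ (relative to $A$) is $\Gamma(M)=\mathrm{Row}(A)\cap\mathbb{Z}^E$, where $\mathrm{Row}(A)\subseteq\mathbb{R}^E$ is the real row space of $A$, equipped with the Euclidean dot product. Two lattices are \emph{isometric} if there is an isomorphism of abelian groups between them that preserves the bilinear forms. Let $M^\circ$ denote the matroid obtained from $M$ by deleting all loops. Let $M$ and $N$ be regular matroids. Then $\Gamma(M)$ and $\Gamma(N)$, formed with respect to any totally unimodular representations of $M$ and $N$, are isometric if and only if $M^\circ$ and $N^\circ$ are isomorphic. -/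

import Mathlib

open scoped Matroid

namespace RegularMatroid

universe u v

/-- `A` is a totally unimodular representation of the matroid `M` (on a finite ground set `M.E`):
an `r × |M.E|` totally unimodular integer matrix of rank `r`, with columns labelled by `M.E`, whose
column matroid over `ℝ` is `M`. -/
structure IsTURepresentation {α : Type u} (M : Matroid α) [Fintype M.E] {r : ℕ}
    (A : Matrix (Fin r) M.E ℤ) : Prop where
  totallyUnimodular : A.IsTotallyUnimodular
  rank_eq : (A.map (Int.cast : ℤ → ℝ)).rank = r
  indep_iff : ∀ I : Set M.E,
    M.Indep (Subtype.val '' I) ↔ LinearIndepOn ℝ (A.map (Int.cast : ℤ → ℝ)).col I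

/-- A matroid on a finite ground set is regular if it is the column matroid over `ℝ` of some
totally unimodular matrix of full row rank. -/
def IsRegular {α : Type u} (M : Matroid α) [Fintype M.E] : Prop :=
  ∃ (r : ℕ) (A : Matrix (Fin r) M.E ℤ), IsTURepresentation M A

/-- The lattice `Row(A) ∩ ℤ^E`, where `Row(A) ⊆ ℝ^E` is the real row space of `A`. When `A` is a
totally unimodular representation of a regular matroid `M`, this is the lattice of integer cuts
of `M` (relative to `A`). -/
def cutLattice {E : Type u} {r : ℕ} (A : Matrix (Fin r) E ℤ) : AddSubgroup (E → ℤ) where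
  carrier := {x | (fun e => (x e : ℝ)) ∈
    Submodule.span ℝ (Set.range (A.map (Int.cast : ℤ → ℝ)).row)}
  zero_mem' := by
    have h : (fun e : E => (((0 : E → ℤ) e : ℤ) : ℝ)) = 0 := by ext; simp
    rw [Set.mem_ofPred_eq, h]
    exact Submodule.zero_mem _
  add_mem' := by
    intro x y hx hy
    have h : (fun e : E => (((x + y) e : ℤ) : ℝ))
        = (fun e => (x e : ℝ)) + (fun e => (y e : ℝ)) := by ext; simp
    rw [Set.mem_ofPred_eq, h]
    exact Submodule.add_mem _ hx hy
  neg_mem' := by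
    intro x hx
    have h : (fun e : E => (((-x) e : ℤ) : ℝ)) = -(fun e => (x e : ℝ)) := by ext; simp
    rw [Set.mem_ofPred_eq, h]
    exact Submodule.neg_mem _ hx

/-- Two lattices of integer vectors are isometric if there is an isomorphism of abelian groups
between them that preserves the Euclidean dot product (its inverse then preserves it as well). -/
def Isometric {E : Type u} {F : Type v} [Fintype E] [Fintype F]
    (L : AddSubgroup (E → ℤ)) (L' : AddSubgroup (F → ℤ)) : Prop :=
  ∃ ψ : L ≃+ L', ∀ x y : L,
    ((ψ x : L') : F → ℤ) ⬝ᵥ ((ψ y : L') : F → ℤ) = (x : E → ℤ) ⬝ᵥ (y : E → ℤ)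

/-- Two matroids are isomorphic if some bijection between their ground sets preserves
independence in both directions. -/
def Isomorphic {α : Type u} {β : Type v} (M : Matroid α) (N : Matroid β) : Prop :=
  ∃ e : M.E ≃ N.E, ∀ I : Set M.E,
    M.Indep (Subtype.val '' I) ↔ N.Indep (Subtype.val '' (e '' I))

/-- The matroid `M°` obtained from `M` by deleting all loops. -/
def deleteLoops {α : Type u} (M : Matroid α) : Matroid α := M ＼ M.loops

end RegularMatroid

/-!
By total unimodularity, the half of a vector of `Γ(M)` can be rounded to a vector of `Γ(M)`, so
every class of the binary code `Γ(M) / 2 Γ(M)` has a representative with entries `0` and `±1`. The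
weight of a class is therefore the minimum of `⟨x, x⟩` over its representatives `x`, and an isometry
of lattices preserves the weights of the codes. By the MacWilliams extension theorem, a consequence
of the linear independence of characters, it comes from a bijection of the nonzero coordinates.
These are the nonloops, and the binary matroid of the coordinates is `M` because the minors of `A`
are `0` or `±1`.

Conversely, row operations over `ℤ` bring a totally unimodular representation into the form that
has an identity matrix in the columns of a basis. The matroid determines the support of this form,
and a totally unimodular matrix is determined by its support up to signs of rows and columns
(Camion): the signs of one column relative to the others are propagated along walks through the
rows, which are shortened by pivoting. None of these changes affects the lattice up to isometry.
-/

namespace RegularMatroid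

open Matrix

section TotallyUnimodular

variable {m n R : Type*} [CommRing R] {A : Matrix m n R} {x y : R}

theorem mem_range_signCast_iff :
    x ∈ Set.range (SignType.cast : SignType → R) ↔ x = 0 ∨ x = 1 ∨ x = -1 := by
  constructor
  · rintro ⟨s, rfl⟩
    cases s <;> simp
  · rintro (rfl | rfl | rfl)
    exacts [⟨0, by simp⟩, ⟨1, by simp⟩, ⟨-1, by simp⟩]

theorem mul_mem_range_signCast (hx : x ∈ Set.range (SignType.cast : SignType → R))
    (hy : y ∈ Set.range (SignType.cast : SignType → R)) :
    x * y ∈ Set.range (SignType.cast : SignType → R) := by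
  rw [mem_range_signCast_iff] at *
  rcases hx with rfl | rfl | rfl <;> rcases hy with rfl | rfl | rfl <;> simp

theorem prod_mem_range_signCast {ι : Type*} [Fintype ι] {f : ι → R}
    (hf : ∀ i, f i ∈ Set.range (SignType.cast : SignType → R)) :
    ∏ i, f i ∈ Set.range (SignType.cast : SignType → R) :=
  Finset.prod_induction f (· ∈ Set.range SignType.cast) (fun _ _ => mul_mem_range_signCast)
    ⟨1, by simp⟩ fun i _ => hf i

theorem mul_self_eq_one_of_mem_range_signCast
    (hx : x ∈ Set.range (SignType.cast : SignType → R)) (hx0 : x ≠ 0) : x * x = 1 := by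
  rcases mem_range_signCast_iff.1 hx with rfl | rfl | rfl
  exacts [absurd rfl hx0, mul_one 1, by simp]

theorem isUnit_iff_ne_zero_of_mem_range_signCast [Nontrivial R]
    (hx : x ∈ Set.range (SignType.cast : SignType → R)) : IsUnit x ↔ x ≠ 0 :=
  ⟨IsUnit.ne_zero, fun hx0 => .of_mul_eq_one x (mul_self_eq_one_of_mem_range_signCast hx hx0)⟩

theorem isTotallyUnimodular_sign_mul (hA : A.IsTotallyUnimodular) {ρ : m → R} {σ : n → R}
    (hρ : ∀ i, ρ i ∈ Set.range (SignType.cast : SignType → R))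
    (hσ : ∀ j, σ j ∈ Set.range (SignType.cast : SignType → R)) :
    (of fun i j => ρ i * σ j * A i j).IsTotallyUnimodular := by
  rw [isTotallyUnimodular_iff] at hA ⊢
  intro k f g
  have hfactor : (of fun i j => ρ i * σ j * A i j).submatrix f g =
      of fun i j => ρ (f i) * (of fun i j => σ (g j) * A.submatrix f g i j) i j := by
    ext i j
    simp [mul_assoc]
  rw [hfactor, det_mul_column, det_mul_row]
  exact mul_mem_range_signCast (prod_mem_range_signCast fun i => hρ (f i))
    (mul_mem_range_signCast (prod_mem_range_signCast fun j => hσ (g j)) (hA k f g))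

/-- The Schur complement of `A` at the pivot entry `A k c`, used to shorten paths in the signing
argument. It is padded with zeros in the pivot row and column, and the pivot stands in for its own
inverse, which is legitimate for a pivot `1` or `-1`. -/
def schurComplement (A : Matrix m n R) (k : m) (c : n) : Matrix m n R :=
  of fun i j => A i j - A i c * A k c * A k j

theorem schurComplement_apply_of_pivot_col_eq_zero {i k : m} {c : n} (h : A i c = 0) (j : n) :
    schurComplement A k c i j = A i j := by
  simp [schurComplement, h]

theorem schurComplement_apply_of_pivot_row_eq_zero {k : m} {c j : n} (h : A k j = 0) (i : m) :
    schurComplement A k c i j = A i j := by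
  simp [schurComplement, h]

theorem isTotallyUnimodular_schurComplement (hA : A.IsTotallyUnimodular) {k : m} {c : n}
    (hkc : A k c ≠ 0) : (schurComplement A k c).IsTotallyUnimodular := by
  have hpivot := mul_self_eq_one_of_mem_range_signCast (hA.apply k c) hkc
  rw [isTotallyUnimodular_iff]
  intro l f g
  let P : Matrix Unit Unit R := of fun _ _ => A k c
  have hPP : P * P = 1 := by
    ext
    simp [P, Matrix.mul_apply, hpivot]
  let _ : Invertible P := ⟨P, hPP, hPP⟩
  have hblocks : A.submatrix (Sum.elim (fun _ : Unit => k) f) (Sum.elim (fun _ : Unit => c) g) =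
      fromBlocks P (of fun _ j => A k (g j)) (of fun i _ => A (f i) c) (A.submatrix f g) := by
    ext (i | i) (j | j) <;> rfl
  have hschur : A.submatrix f g - (of fun i (_ : Unit) => A (f i) c) * ⅟P *
      (of fun (_ : Unit) j => A k (g j)) = (schurComplement A k c).submatrix f g := by
    ext i j
    change _ - (_ * P * _ : Matrix (Fin l) (Fin l) R) i j = _
    simp [Matrix.mul_apply, P, schurComplement]
  have hdet : (A.submatrix (Sum.elim (fun _ : Unit => k) f) (Sum.elim (fun _ : Unit => c) g)).det =
      A k c * ((schurComplement A k c).submatrix f g).det := by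
    rw [hblocks, det_fromBlocks₁₁, hschur]
    simp [P]
  have hbordered := (isTotallyUnimodular_iff_fintype A).1 hA (Unit ⊕ Fin l)
    (Sum.elim (fun _ => k) f) (Sum.elim (fun _ => c) g)
  rw [hdet] at hbordered
  simpa only [← mul_assoc, hpivot, one_mul] using
    mul_mem_range_signCast (hA.apply k c) hbordered

theorem isTotallyUnimodular_of_maximal_minors [Fintype m] [DecidableEq m] {b : m → n}
    (hb : A.submatrix id b = 1)
    (hA : ∀ g : m → n, (A.submatrix id g).det ∈ Set.range (SignType.cast : SignType → R)) :
    A.IsTotallyUnimodular := by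
  classical
  intro k f g hf _
  -- Filling up the columns `g` with the unit columns of the rows outside `f` keeps the minor.
  let e : Fin k ≃ Set.range f := Equiv.ofInjective f hf
  let g' : m → n := fun i => if hi : i ∈ Set.range f then g (e.symm ⟨i, hi⟩) else b i
  have hunit (i j) : A i (b j) = (1 : Matrix m m R) i j := congr($hb i j)
  have hdet := hA g'
  rw [twoBlockTriangular_det' _ (· ∈ Set.range f)] at hdet
  · have hlower : toSquareBlockProp (A.submatrix id g') (· ∉ Set.range f) = 1 := by
      ext ⟨i, hi⟩ ⟨j, hj⟩
      simp only [toSquareBlockProp_def, of_apply, submatrix_apply, id, g', dif_neg hj, hunit,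
        one_apply, Subtype.mk.injEq]
    have hupper : A.submatrix f g =
        (toSquareBlockProp (A.submatrix id g') (· ∈ Set.range f)).submatrix e e := by
      ext i j
      simp [toSquareBlockProp_def, g', e]
    rw [hupper, det_submatrix_equiv_self]
    rw [hlower, det_one, mul_one] at hdet
    convert hdet
  · intro i hi j hj
    have hij : i ≠ j := fun h => hj (h ▸ hi)
    simp only [submatrix_apply, id, g', dif_neg hj, hunit, one_apply, if_neg hij]

end TotallyUnimodular

section ColumnBasis

variable {m n R : Type*} [CommRing R] [Fintype m] [DecidableEq m] {A : Matrix m n R} {b : m → n}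

/-- The columns `b` of `A`, taken in this order, form a basis of the free module `m → R`: they are
the columns of an invertible matrix. -/
def IsColumnBasis (A : Matrix m n R) (b : m → n) : Prop :=
  IsUnit (A.submatrix id b).det

/-- The matrix `A_b⁻¹ A`, which for a column basis `b` is the row transform of `A` that has an
identity matrix in the columns `b`. -/
noncomputable def standardForm (A : Matrix m n R) (b : m → n) : Matrix m n R :=
  (A.submatrix id b)⁻¹ * A

theorem submatrix_mul_standardForm (hb : IsColumnBasis A b) :
    A.submatrix id b * standardForm A b = A := by
  rw [standardForm, ← Matrix.mul_assoc, mul_nonsing_inv _ hb, Matrix.one_mul]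

theorem standardForm_submatrix (hb : IsColumnBasis A b) :
    (standardForm A b).submatrix id b = 1 := by
  rw [standardForm, submatrix_mul _ _ id id b Function.bijective_id, submatrix_id_id,
    nonsing_inv_mul _ hb]

theorem det_mul_det_standardForm_submatrix (hb : IsColumnBasis A b) (g : m → n) :
    (A.submatrix id b).det * ((standardForm A b).submatrix id g).det =
      (A.submatrix id g).det := by
  rw [← det_mul]
  conv_rhs => rw [← submatrix_mul_standardForm hb,
    submatrix_mul _ _ id id g Function.bijective_id, submatrix_id_id]

theorem det_standardForm_submatrix_update (hb : IsColumnBasis A b) (i : m) (e : n) :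
    ((standardForm A b).submatrix id (Function.update b i e)).det = standardForm A b i e := by
  have hupdate : (standardForm A b).submatrix id (Function.update b i e) =
      (1 : Matrix m m R).updateCol i fun k => standardForm A b k e := by
    rw [← standardForm_submatrix hb]
    ext j k
    by_cases hk : k = i <;> simp [hk]
  rw [hupdate, ← cramer_apply, cramer_one, Module.End.one_apply]

theorem isUnit_standardForm_apply_iff (hb : IsColumnBasis A b) (i : m) (e : n) :
    IsUnit (standardForm A b i e) ↔ IsColumnBasis A (Function.update b i e) := by
  rw [IsColumnBasis, ← det_mul_det_standardForm_submatrix hb, IsUnit.mul_iff,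
    det_standardForm_submatrix_update hb]
  exact (and_iff_right hb).symm

theorem linearIndependent_row_of_isColumnBasis (hb : IsColumnBasis A b) :
    LinearIndependent R A.row := by
  rw [← vecMul_injective_iff]
  intro y z hyz
  exact vecMul_injective_of_isUnit ((isUnit_iff_isUnit_det _).2 hb) congr($hyz ∘ b)

theorem isTotallyUnimodular_standardForm (hA : A.IsTotallyUnimodular) (hb : IsColumnBasis A b) :
    (standardForm A b).IsTotallyUnimodular := by
  refine isTotallyUnimodular_of_maximal_minors (standardForm_submatrix hb) fun g => ?_
  rcases subsingleton_or_nontrivial R with _ | _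
  · exact ⟨0, Subsingleton.elim _ _⟩
  have hA' := (isTotallyUnimodular_iff_fintype A).1 hA m id
  have hbb := mul_self_eq_one_of_mem_range_signCast (hA' b) hb.ne_zero
  rw [← one_mul (det _), ← hbb, mul_assoc, det_mul_det_standardForm_submatrix hb]
  exact mul_mem_range_signCast (hA' b) (hA' g)

theorem isColumnBasis_iff_linearIndependent {K : Type*} [Field K] {A : Matrix m n K} {b : m → n} :
    IsColumnBasis A b ↔ LinearIndependent K (A.col ∘ b) := by
  rw [IsColumnBasis, ← isUnit_iff_isUnit_det, ← linearIndependent_cols_iff_isUnit]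
  rfl

theorem exists_isColumnBasis {K : Type*} [Field K] [Finite n] {A : Matrix m n K}
    (hA : LinearIndependent K A.row) : ∃ b : m → n, IsColumnBasis A b := by
  cases nonempty_fintype n
  obtain ⟨κ, a, ha, hspan, hindep⟩ := exists_linearIndependent' K A.col
  have := Finite.of_injective a ha
  cases nonempty_fintype κ
  have hcard : Fintype.card m = Fintype.card κ := by
    rw [← hA.rank_matrix, rank_eq_finrank_span_cols, ← hspan, finrank_span_eq_card hindep]
  let e : m ≃ κ := Fintype.equivOfCardEq hcard
  exact ⟨a ∘ e, isColumnBasis_iff_linearIndependent.2 (hindep.comp e e.injective)⟩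

theorem linearIndependent_col_iff_exists_isColumnBasis_transpose {K : Type*} [Field K] [Finite n]
    {A : Matrix n m K} : LinearIndependent K A.col ↔ ∃ f : m → n, IsColumnBasis Aᵀ f := by
  refine ⟨fun hA => exists_isColumnBasis hA, fun ⟨f, hf⟩ => ?_⟩
  rw [IsColumnBasis, ← det_transpose] at hf
  exact .of_comp (LinearMap.funLeft K K f)
    ((isColumnBasis_iff_linearIndependent (A := A.submatrix f id) (b := id)).1 hf)

end ColumnBasis

section IntCast

variable {m n R : Type*} [CommRing R] [Nontrivial R]

theorem isUnit_intCast_iff_of_mem_range_signCast {x : ℤ}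
    (hx : x ∈ Set.range (SignType.cast : SignType → ℤ)) : IsUnit (x : R) ↔ IsUnit x := by
  rcases mem_range_signCast_iff.1 hx with rfl | rfl | rfl <;> simp

theorem isColumnBasis_map_intCast_iff [Fintype m] [DecidableEq m] {A : Matrix m n ℤ}
    (hA : A.IsTotallyUnimodular) {b : m → n} :
    IsColumnBasis (A.map (Int.cast : ℤ → R)) b ↔ IsColumnBasis A b := by
  rw [IsColumnBasis, submatrix_map, ← Int.cast_det]
  exact isUnit_intCast_iff_of_mem_range_signCast
    ((isTotallyUnimodular_iff_fintype A).1 hA m id b)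

theorem linearIndependent_col_map_intCast_iff {K : Type*} [Field K] [Finite m] [Fintype n]
    [DecidableEq n] {A : Matrix m n ℤ} (hA : A.IsTotallyUnimodular) :
    LinearIndependent K (A.map (Int.cast : ℤ → K)).col ↔ ∃ f : n → m, IsColumnBasis Aᵀ f := by
  rw [linearIndependent_col_iff_exists_isColumnBasis_transpose, ← transpose_map]
  exact exists_congr fun f => isColumnBasis_map_intCast_iff hA.transpose

theorem linearIndepOn_col_map_intCast_iff [Finite m] [Finite n] {A : Matrix m n ℤ}
    (hA : A.IsTotallyUnimodular) (K L : Type*) [Field K] [Field L] (I : Set n) :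
    LinearIndepOn K (A.map (Int.cast : ℤ → K)).col I ↔
      LinearIndepOn L (A.map (Int.cast : ℤ → L)).col I := by
  classical
  cases nonempty_fintype I
  have hAI : (A.submatrix id ((↑) : I → n)).IsTotallyUnimodular := hA.submatrix id _
  exact (linearIndependent_col_map_intCast_iff hAI).trans
    (linearIndependent_col_map_intCast_iff hAI).symm

end IntCast

section CutLattice

variable {E : Type*} {r : ℕ} {A : Matrix (Fin r) E ℤ} {b : Fin r → E}

theorem row_mem_cutLattice (A : Matrix (Fin r) E ℤ) (i : Fin r) : A.row i ∈ cutLattice A :=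
  Submodule.subset_span ⟨i, rfl⟩

theorem mem_cutLattice_iff {x : E → ℤ} :
    x ∈ cutLattice A ↔
      ∃ y : Fin r → ℝ, y ᵥ* A.map (Int.cast : ℤ → ℝ) = fun e => (x e : ℝ) := by
  change _ ∈ Submodule.span ℝ _ ↔ _
  rw [← range_vecMulLinear]
  rfl

theorem intCast_vecMul_map_intCast {m n R : Type*} [Fintype m] [CommRing R] (y : m → ℤ)
    (A : Matrix m n ℤ) :
    (fun i => (y i : R)) ᵥ* A.map Int.cast = fun j => ((y ᵥ* A) j : R) :=
  funext fun j => ((Int.castRingHom R).map_vecMul A y j).symm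

theorem exists_intCast_eq_of_intCast_eq_vecMul_comp {m n R : Type*} [Fintype m] [DecidableEq m]
    [CommRing R] {A : Matrix m n ℤ} {b : m → n} (hb : IsColumnBasis A b) {y : m → R} {z : m → ℤ}
    (hz : ∀ i, (y ᵥ* A.map (Int.cast : ℤ → R)) (b i) = z i) :
    ∃ w : m → ℤ, y = fun i => (w i : R) := by
  have hunit : IsUnit ((A.submatrix id b).map (Int.cast : ℤ → R)) :=
    ((isUnit_iff_isUnit_det _).2 hb).map (Int.castRingHom R).mapMatrix
  refine ⟨z ᵥ* (A.submatrix id b)⁻¹, vecMul_injective_of_isUnit hunit ?_⟩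
  change y ᵥ* _ = _ ᵥ* _
  rw [intCast_vecMul_map_intCast, vecMul_vecMul, nonsing_inv_mul _ hb, vecMul_one]
  exact funext hz

theorem mem_cutLattice_iff_exists_vecMul (hb : IsColumnBasis A b) {x : E → ℤ} :
    x ∈ cutLattice A ↔ ∃ y : Fin r → ℤ, y ᵥ* A = x := by
  rw [mem_cutLattice_iff]
  constructor
  · rintro ⟨y, hy⟩
    obtain ⟨w, rfl⟩ := exists_intCast_eq_of_intCast_eq_vecMul_comp hb fun i => congrFun hy (b i)
    rw [intCast_vecMul_map_intCast] at hy
    exact ⟨w, funext fun e => Int.cast_injective (congrFun hy e)⟩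
  · rintro ⟨y, rfl⟩
    exact ⟨_, intCast_vecMul_map_intCast y A⟩

theorem cutLattice_mul_left {U : Matrix (Fin r) (Fin r) ℤ} (hU : IsUnit U.det)
    (A : Matrix (Fin r) E ℤ) : cutLattice (U * A) = cutLattice A := by
  have hunit : IsUnit (U.map (Int.cast : ℤ → ℝ)) :=
    ((isUnit_iff_isUnit_det _).2 hU).map (Int.castRingHom ℝ).mapMatrix
  have hsurjective : Function.Surjective (· ᵥ* U.map (Int.cast : ℤ → ℝ)) :=
    vecMul_surjective_iff_isUnit.2 hunit
  have hmap : (U * A).map (Int.cast : ℤ → ℝ) =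
      U.map (Int.cast : ℤ → ℝ) * A.map (Int.cast : ℤ → ℝ) :=
    Matrix.map_mul (f := Int.castRingHom ℝ)
  ext x
  simpa only [mem_cutLattice_iff, hmap, vecMul_vecMul] using (hsurjective.exists
    (p := fun y => y ᵥ* A.map (Int.cast : ℤ → ℝ) = fun e : E => (x e : ℝ))).symm

theorem cutLattice_standardForm (hb : IsColumnBasis A b) :
    cutLattice (standardForm A b) = cutLattice A :=
  cutLattice_mul_left (isUnit_nonsing_inv_det _ hb) A

end CutLattice

section Rounding

variable {E : Type*} [Finite E]

theorem exists_mem_Icc_eq_zero_of_eq_zero_on_tight (V : Submodule ℝ (E → ℝ)) {l u : E → ℝ}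
    (hV : ((V : Set (E → ℝ)) ∩ Set.Icc l u).Nonempty) :
    ∃ v ∈ V, v ∈ Set.Icc l u ∧
      ∀ w ∈ V, (∀ e, v e = l e ∨ v e = u e → w e = 0) → w = 0 := by
  obtain ⟨v, ⟨hv, hlu⟩, hext⟩ :=
    (isCompact_Icc.inter_left V.closed_of_finiteDimensional).extremePoints_nonempty hV
  refine ⟨v, hv, hlu, fun w hw htight => ?_⟩
  have hnear : ∀ᶠ t in nhds (0 : ℝ), v + t • w ∈ Set.Icc l u := by
    have hcoord (e : E) : ∀ᶠ t in nhds (0 : ℝ), (v + t • w) e ∈ Set.Icc (l e) (u e) := by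
      by_cases he : v e = l e ∨ v e = u e
      · simp [htight e he, hlu.1 e, hlu.2 e]
      · push Not at he
        have hcont : ContinuousAt (fun t : ℝ => (v + t • w) e) 0 := by fun_prop
        refine hcont.eventually_mem (Icc_mem_nhds ?_ ?_)
        · simpa using (hlu.1 e).lt_of_ne' he.1
        · simpa using (hlu.2 e).lt_of_ne he.2
    filter_upwards [Filter.eventually_all.2 hcoord] with t ht
    exact ⟨fun e => (ht e).1, fun e => (ht e).2⟩
  have hneg : ∀ᶠ t in nhds (0 : ℝ), v + -t • w ∈ Set.Icc l u :=
    (continuous_neg.tendsto' (0 : ℝ) 0 neg_zero).eventually hnear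
  obtain ⟨t, ⟨hplus, hminus⟩, ht⟩ :=
    ((hnear.and hneg).filter_mono nhdsWithin_le_nhds |>.and self_mem_nhdsWithin :
      ∀ᶠ t in nhdsWithin (0 : ℝ) (Set.Ioi 0), _).exists
  have hmid : v ∈ openSegment ℝ (v + t • w) (v + -t • w) :=
    ⟨1 / 2, 1 / 2, by norm_num, by norm_num, by norm_num, by module⟩
  have heq : v + t • w = v := hext ⟨V.add_mem hv (V.smul_mem _ hw), hplus⟩
    ⟨V.add_mem hv (V.smul_mem _ hw), hminus⟩ hmid
  simpa [ht.ne'] using heq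

/-- Every class of `L` modulo `2 L` has a representative with entries `0` and `±1`, namely
`x - 2 g`. The squared norm of such a representative is its Hamming weight modulo `2`. -/
def HasSmallRepresentativesModTwo (L : AddSubgroup (E → ℤ)) : Prop :=
  ∀ x ∈ L, ∃ g ∈ L, ∀ e, |x e - 2 * g e| ≤ 1

variable {r : ℕ} {A : Matrix (Fin r) E ℤ} {b : Fin r → E}

/- An extreme point of the polytope of real solutions is integral: the columns of its tight
coordinates have full rank, so they contain a column basis. -/
theorem exists_mem_cutLattice_mem_Icc (hA : A.IsTotallyUnimodular) (hb : IsColumnBasis A b)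
    {l u : E → ℤ} {y : Fin r → ℝ} (hl : ∀ e, l e ≤ (y ᵥ* A.map (Int.cast : ℤ → ℝ)) e)
    (hu : ∀ e, (y ᵥ* A.map (Int.cast : ℤ → ℝ)) e ≤ u e) :
    ∃ z ∈ cutLattice A, z ∈ Set.Icc l u := by
  obtain ⟨_, ⟨v, rfl⟩, ⟨hlv, hvu⟩, hext⟩ := exists_mem_Icc_eq_zero_of_eq_zero_on_tight
    (LinearMap.range (A.map (Int.cast : ℤ → ℝ)).vecMulLinear) ⟨_, ⟨y, rfl⟩, hl, hu⟩
  simp only [vecMulLinear_apply] at hlv hvu hext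
  let T : Set E := {e | (v ᵥ* A.map (Int.cast : ℤ → ℝ)) e = l e ∨
    (v ᵥ* A.map (Int.cast : ℤ → ℝ)) e = u e}
  have htight (e : T) : ∃ k : ℤ, (v ᵥ* A.map (Int.cast : ℤ → ℝ)) e = k :=
    e.2.elim (fun h => ⟨_, h⟩) fun h => ⟨_, h⟩
  have hindep :
      LinearIndependent ℝ ((A.map (Int.cast : ℤ → ℝ)).submatrix id ((↑) : T → E)).row := by
    rw [← vecMul_injective_iff]
    refine (injective_iff_map_eq_zero (vecMulLinear _)).2 fun w hw => ?_
    have hzero : w ᵥ* A.map (Int.cast : ℤ → ℝ) = 0 :=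
      hext _ ⟨w, rfl⟩ fun e he => congrFun hw ⟨e, he⟩
    exact vecMul_injective_iff.2 (linearIndependent_row_of_isColumnBasis
      ((isColumnBasis_map_intCast_iff hA).2 hb)) (hzero.trans (zero_vecMul _).symm)
  obtain ⟨b', hb'⟩ := exists_isColumnBasis hindep
  have hb'' : IsColumnBasis A (fun i => b' i) := (isColumnBasis_map_intCast_iff hA (R := ℝ)).1 hb'
  choose k hk using htight
  obtain ⟨w, rfl⟩ := exists_intCast_eq_of_intCast_eq_vecMul_comp hb'' fun i => hk (b' i)
  rw [intCast_vecMul_map_intCast] at hlv hvu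
  refine ⟨w ᵥ* A, (mem_cutLattice_iff_exists_vecMul hb).2 ⟨w, rfl⟩, fun e => ?_, fun e => ?_⟩
  · exact Int.cast_le.1 (hlv e)
  · exact Int.cast_le.1 (hvu e)

theorem hasSmallRepresentativesModTwo_cutLattice (hA : A.IsTotallyUnimodular)
    (hb : IsColumnBasis A b) : HasSmallRepresentativesModTwo (cutLattice A) := by
  intro x hx
  obtain ⟨y, hy⟩ := mem_cutLattice_iff.1 hx
  have hhalf (e : E) : (((1 / 2 : ℝ) • y) ᵥ* A.map (Int.cast : ℤ → ℝ)) e = x e / 2 := by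
    rw [smul_vecMul, hy]
    simp only [Pi.smul_apply, smul_eq_mul]
    ring
  obtain ⟨g, hg, hlg, hgu⟩ := exists_mem_cutLattice_mem_Icc hA hb
    (l := fun e => x e / 2) (u := fun e => (x e + 1) / 2) (y := (1 / 2 : ℝ) • y)
    (fun e => by
      rw [hhalf, le_div_iff₀ two_pos]
      norm_cast
      omega)
    (fun e => by
      rw [hhalf, div_le_iff₀ two_pos]
      norm_cast
      omega)
  refine ⟨g, hg, fun e => ?_⟩
  have hlge : x e / 2 ≤ g e := hlg e
  have hgue : g e ≤ (x e + 1) / 2 := hgu e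
  rw [abs_le]
  constructor <;> omega

end Rounding

section Isometric

variable {E F : Type*} [Fintype E] [Fintype F]

theorem Isometric.symm {L : AddSubgroup (E → ℤ)} {L' : AddSubgroup (F → ℤ)}
    (h : Isometric L L') : Isometric L' L := by
  obtain ⟨ψ, hψ⟩ := h
  exact ⟨ψ.symm, fun x y => by simp only [← hψ, ψ.apply_symm_apply]⟩

theorem Isometric.trans {G : Type*} [Fintype G] {L : AddSubgroup (E → ℤ)}
    {L' : AddSubgroup (F → ℤ)} {L'' : AddSubgroup (G → ℤ)} (h : Isometric L L')
    (h' : Isometric L' L'') : Isometric L L'' := by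
  obtain ⟨ψ, hψ⟩ := h
  obtain ⟨ψ', hψ'⟩ := h'
  exact ⟨ψ.trans ψ', fun x y => (hψ' (ψ x) (ψ y)).trans (hψ x y)⟩

theorem isometric_map {L : AddSubgroup (E → ℤ)} (f : (E → ℤ) →+ (F → ℤ))
    (hf : ∀ x ∈ L, ∀ y ∈ L, f x ⬝ᵥ f y = x ⬝ᵥ y) : Isometric L (L.map f) := by
  have hinjective : Function.Injective (f.addSubgroupMap L) := by
    refine (injective_iff_map_eq_zero _).2 fun x hx => Subtype.ext ?_
    rw [ZeroMemClass.coe_zero, ← dotProduct_self_eq_zero, ← hf x x.2 x x.2,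
      show f x = 0 from congrArg Subtype.val hx, dotProduct_zero]
  exact ⟨.ofBijective (f.addSubgroupMap L) ⟨hinjective, f.addSubgroupMap_surjective L⟩,
    fun x y => hf x x.2 y y.2⟩

variable {r : ℕ}

theorem isometric_cutLattice_submatrix {A : Matrix (Fin r) E ℤ} {a : F → E}
    (ha : Function.Injective a) (hA : ∀ e ∉ Set.range a, A.col e = 0) :
    Isometric (cutLattice A) (cutLattice (A.submatrix id a)) := by
  have hzero (y : Fin r → ℝ) (e : E) (he : e ∉ Set.range a) :
      (y ᵥ* A.map (Int.cast : ℤ → ℝ)) e = 0 := by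
    have hcol : (A.map (Int.cast : ℤ → ℝ)).col e = 0 :=
      funext fun i => by simpa using congrFun (hA e he) i
    exact (congrArg (y ⬝ᵥ ·) hcol).trans (dotProduct_zero y)
  have hmap : (cutLattice A).map (LinearMap.funLeft ℤ ℤ a).toAddMonoidHom =
      cutLattice (A.submatrix id a) := by
    ext x
    rw [AddSubgroup.mem_map, mem_cutLattice_iff]
    constructor
    · rintro ⟨x, hx, rfl⟩
      obtain ⟨y, hy⟩ := mem_cutLattice_iff.1 hx
      exact ⟨y, congr($hy ∘ a)⟩
    · rintro ⟨y, hy⟩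
      refine ⟨Function.extend a x 0, mem_cutLattice_iff.2 ⟨y, funext fun e => ?_⟩,
        Function.extend_comp ha x 0⟩
      by_cases he : e ∈ Set.range a
      · obtain ⟨f, rfl⟩ := he
        rw [ha.extend_apply]
        exact congrFun hy f
      · rw [hzero y e he, Function.extend_apply' _ _ _ he, Pi.zero_apply, Int.cast_zero]
  rw [← hmap]
  refine isometric_map _ fun x hx z _ =>
    Fintype.sum_of_injective a ha _ _ (fun e he => ?_) fun _ => rfl
  obtain ⟨y, hy⟩ := mem_cutLattice_iff.1 hx
  rw [Int.cast_injective (((congrFun hy e).symm.trans (hzero y e he)).trans Int.cast_zero.symm),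
    zero_mul]

theorem isometric_cutLattice_sign_mul_col (A : Matrix (Fin r) E ℤ) (σ : E → ℤˣ) :
    Isometric (cutLattice A) (cutLattice (of fun i j => (σ j : ℤ) * A i j)) := by
  have hσ (e : E) (k : ℤ) : (σ e : ℤ) * (σ e * k) = k := by
    rw [← mul_assoc, ← Units.val_mul, Int.units_mul_self, Units.val_one, one_mul]
  have hcomb (y : Fin r → ℝ) (e : E) :
      (y ᵥ* (of fun i j => (σ j : ℤ) * A i j).map (Int.cast : ℤ → ℝ)) e =
        (σ e : ℤ) * (y ᵥ* A.map (Int.cast : ℤ → ℝ)) e := by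
    simp only [vecMul, dotProduct, map_apply, of_apply, Int.cast_mul, Finset.mul_sum]
    exact Finset.sum_congr rfl fun i _ => mul_left_comm ..
  have hmap : (cutLattice A).map (AddMonoidHom.mulLeft fun e => (σ e : ℤ)) =
      cutLattice (of fun i j => (σ j : ℤ) * A i j) := by
    ext z
    rw [AddSubgroup.mem_map, mem_cutLattice_iff]
    constructor
    · rintro ⟨x, hx, rfl⟩
      obtain ⟨y, hy⟩ := mem_cutLattice_iff.1 hx
      exact ⟨y, funext fun e => by simp [hcomb, hy]⟩
    · rintro ⟨y, hy⟩
      refine ⟨fun e => σ e * z e, mem_cutLattice_iff.2 ⟨y, funext fun e => ?_⟩,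
        funext fun e => hσ e (z e)⟩
      rw [Int.cast_mul, ← congrFun hy e, hcomb, ← mul_assoc, ← Int.cast_mul, ← Units.val_mul,
        Int.units_mul_self, Units.val_one, Int.cast_one, one_mul]
  rw [← hmap]
  refine isometric_map _ fun x _ y _ => Finset.sum_congr rfl fun e _ => ?_
  change (σ e * x e : ℤ) * (σ e * y e) = x e * y e
  rw [mul_mul_mul_comm, mul_assoc, hσ]

theorem isometric_cutLattice_sign_mul (A : Matrix (Fin r) E ℤ) (ρ : Fin r → ℤˣ) (σ : E → ℤˣ) :
    Isometric (cutLattice A) (cutLattice (of fun i j => (ρ i * σ j : ℤ) * A i j)) := by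
  have hrows : of (fun i j => (ρ i * σ j : ℤ) * A i j) =
      diagonal (fun i => (ρ i : ℤ)) * of fun i j => (σ j : ℤ) * A i j := by
    ext i j
    simp [mul_assoc]
  have hdet : IsUnit (diagonal fun i => (ρ i : ℤ)).det := by simp
  rw [hrows, cutLattice_mul_left hdet]
  exact isometric_cutLattice_sign_mul_col A σ

end Isometric

section ModTwo

variable {E F : Type*}

/-- The coordinate `e` of a lattice reduced modulo `2`. These functionals are the coordinates of
the binary code `L / 2 L`. -/
def coordModTwo (L : AddSubgroup (E → ℤ)) (e : E) : L →+ ZMod 2 :=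
  (Int.castAddHom (ZMod 2)).comp ((Pi.evalAddMonoidHom (fun _ => ℤ) e).comp L.subtype)

theorem linearIndepOn_coordModTwo_cutLattice_iff [Finite E] {r : ℕ} {A : Matrix (Fin r) E ℤ}
    {b : Fin r → E} (hA : A.IsTotallyUnimodular) (hb : IsColumnBasis A b) (I : Set E) :
    LinearIndepOn (ZMod 2) (coordModTwo (cutLattice A)) I ↔
      LinearIndepOn ℝ (A.map (Int.cast : ℤ → ℝ)).col I := by
  let evalRows : (cutLattice A →+ ZMod 2) →+ Fin r → ZMod 2 :=
    { toFun := fun φ i => φ ⟨A.row i, row_mem_cutLattice A i⟩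
      map_zero' := rfl
      map_add' := fun _ _ => rfl }
  have hinjective : Function.Injective evalRows := by
    refine (injective_iff_map_eq_zero _).2 fun φ hφ => AddMonoidHom.ext fun ⟨x, hx⟩ => ?_
    obtain ⟨y, rfl⟩ := (mem_cutLattice_iff_exists_vecMul hb).1 hx
    have hcomb : (⟨y ᵥ* A, hx⟩ : cutLattice A) =
        ∑ i, y i • ⟨A.row i, row_mem_cutLattice A i⟩ := by
      ext e
      simp [vecMul, dotProduct]
    rw [hcomb, map_sum]
    refine Finset.sum_eq_zero fun i _ => ?_
    rw [map_zsmul, show φ ⟨A.row i, row_mem_cutLattice A i⟩ = 0 from congrFun hφ i, smul_zero]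
  rw [linearIndepOn_col_map_intCast_iff hA ℝ (ZMod 2)]
  exact ((evalRows.toZModLinearMap 2).linearIndepOn_iff_of_injOn hinjective.injOn).symm

variable [Fintype E] [Fintype F] {L : AddSubgroup (E → ℤ)} {L' : AddSubgroup (F → ℤ)}

theorem hammingNorm_coordModTwo_le_dotProduct_self (x : L) :
    (hammingNorm (fun e => coordModTwo L e x) : ℤ) ≤ (x : E → ℤ) ⬝ᵥ x := by
  rw [hammingNorm, Finset.natCast_card_filter]
  refine Finset.sum_le_sum fun e _ => ?_
  split_ifs with he
  · refine Int.add_one_le_iff.2 (mul_self_pos.2 fun hx => he ?_)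
    exact (congrArg (Int.cast : ℤ → ZMod 2) hx).trans Int.cast_zero
  · exact mul_self_nonneg _

theorem hammingNorm_coordModTwo_eq_dotProduct_self {x : L} (hx : ∀ e, |(x : E → ℤ) e| ≤ 1) :
    (hammingNorm (fun e => coordModTwo L e x) : ℤ) = (x : E → ℤ) ⬝ᵥ x := by
  rw [hammingNorm, Finset.natCast_card_filter]
  refine Finset.sum_congr rfl fun e _ => ?_
  change (if (((x : E → ℤ) e : ℤ) : ZMod 2) ≠ 0 then 1 else 0 : ℤ) = _
  have hcases : (x : E → ℤ) e = -1 ∨ (x : E → ℤ) e = 0 ∨ (x : E → ℤ) e = 1 := by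
    have := abs_le.1 (hx e)
    omega
  rcases hcases with h | h | h <;> simp [h]

theorem map_sub_two_nsmul {M : Type*} [AddCommGroup M] (φ : M →+ ZMod 2) (x y : M) :
    φ (x - 2 • y) = φ x := by
  rw [map_sub, map_nsmul, CharTwo.two_nsmul, sub_zero]

theorem hammingNorm_coordModTwo_le_of_isometry (hL : HasSmallRepresentativesModTwo L)
    (ψ : L ≃+ L') (hψ : ∀ x, (ψ x : F → ℤ) ⬝ᵥ (ψ x : F → ℤ) = (x : E → ℤ) ⬝ᵥ x) (x : L) :
    hammingNorm (fun f => coordModTwo L' f (ψ x)) ≤ hammingNorm (fun e => coordModTwo L e x) := by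
  obtain ⟨g, hg, hsmall⟩ := hL x x.2
  let g' : L := ⟨g, hg⟩
  have hnorm : (hammingNorm (fun e => coordModTwo L e (x - 2 • g')) : ℤ) =
      ((x - 2 • g' : L) : E → ℤ) ⬝ᵥ (x - 2 • g' : L) :=
    hammingNorm_coordModTwo_eq_dotProduct_self fun e => by simpa [g'] using hsmall e
  have hle := hammingNorm_coordModTwo_le_dotProduct_self (ψ (x - 2 • g'))
  rw [hψ, ← hnorm, map_sub, map_nsmul] at hle
  simp only [map_sub_two_nsmul] at hle
  exact_mod_cast hle

theorem hammingNorm_coordModTwo_eq_of_isometry (hL : HasSmallRepresentativesModTwo L)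
    (hL' : HasSmallRepresentativesModTwo L') (ψ : L ≃+ L')
    (hψ : ∀ x, (ψ x : F → ℤ) ⬝ᵥ (ψ x : F → ℤ) = (x : E → ℤ) ⬝ᵥ x) (x : L) :
    hammingNorm (fun e => coordModTwo L e x) = hammingNorm (fun f => coordModTwo L' f (ψ x)) := by
  refine le_antisymm ?_ (hammingNorm_coordModTwo_le_of_isometry hL ψ hψ x)
  simpa only [ψ.symm_apply_apply] using hammingNorm_coordModTwo_le_of_isometry hL' ψ.symm
    (fun y => by rw [← hψ, ψ.apply_symm_apply]) (ψ x)

end ModTwo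

section MacWilliams

variable {G : Type*} [AddCommGroup G]

/-- The character `x ↦ (-1) ^ φ x` of `G`. Distinct characters are linearly independent, which is
what makes a binary code recoverable from its weights. -/
def signCharacter (φ : G →+ ZMod 2) : Multiplicative G →* ℤ where
  toFun x := if φ x.toAdd = 0 then 1 else -1
  map_one' := by simp
  map_mul' x y := by
    have hmul : ∀ a b : ZMod 2, (if a + b = 0 then 1 else -1 : ℤ) =
        (if a = 0 then 1 else -1) * if b = 0 then 1 else -1 := by decide
    rw [toAdd_mul, map_add, hmul]

theorem signCharacter_injective :
    Function.Injective (signCharacter : (G →+ ZMod 2) → Multiplicative G →* ℤ) := by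
  have heq : ∀ a b : ZMod 2,
      (if a = 0 then 1 else -1 : ℤ) = (if b = 0 then 1 else -1) → a = b := by decide
  exact fun φ χ h => AddMonoidHom.ext fun x =>
    heq _ _ (DFunLike.congr_fun h (Multiplicative.ofAdd x))

theorem linearIndependent_signCharacter :
    LinearIndependent ℤ fun φ : G →+ ZMod 2 => (signCharacter φ : Multiplicative G → ℤ) :=
  (linearIndependent_monoidHom (Multiplicative G) ℤ).comp _ signCharacter_injective

variable {E F : Type*} [Fintype E] [Fintype F] {φ : E → G →+ ZMod 2} {χ : F → G →+ ZMod 2}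

theorem sum_signCharacter (φ : E → G →+ ZMod 2) (x : Multiplicative G) :
    ∑ e, signCharacter (φ e) x =
      (Fintype.card E : ℤ) - 2 * hammingNorm fun e => φ e x.toAdd := by
  rw [hammingNorm, Finset.natCast_card_filter, Finset.mul_sum, ← Finset.card_univ,
    Finset.cast_card, ← Finset.sum_sub_distrib]
  refine Finset.sum_congr rfl fun e _ => ?_
  change (if φ e x.toAdd = 0 then 1 else -1 : ℤ) = _
  split_ifs <;> simp_all

theorem card_fiber_eq_of_hammingNorm_eq
    (h : ∀ x, hammingNorm (fun e => φ e x) = hammingNorm (fun f => χ f x))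
    {μ : G →+ ZMod 2} (hμ : μ ≠ 0) : Nat.card {e // φ e = μ} = Nat.card {f // χ f = μ} := by
  classical
  let c : (G →+ ZMod 2) →₀ ℤ := ∑ e, Finsupp.single (φ e) 1 - ∑ f, Finsupp.single (χ f) 1 +
    Finsupp.single 0 ((Fintype.card F : ℤ) - Fintype.card E)
  have hc : Finsupp.linearCombination ℤ
      (fun ν : G →+ ZMod 2 => (signCharacter ν : Multiplicative G → ℤ)) c = 0 := by
    funext x
    have hzero : signCharacter (0 : G →+ ZMod 2) x = 1 := rfl
    simp only [c, map_add, map_sub, map_sum, Finsupp.linearCombination_single, one_smul,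
      Pi.add_apply, Pi.sub_apply, Finset.sum_apply, Pi.smul_apply, Pi.zero_apply, hzero,
      sum_signCharacter, h x.toAdd, smul_eq_mul]
    ring
  have hcμ : c μ = 0 :=
    DFunLike.congr_fun (linearIndependent_iff.1 linearIndependent_signCharacter c hc) μ
  simp only [c, Finsupp.add_apply, Finsupp.sub_apply, Finsupp.finsetSum_apply,
    Finsupp.single_apply, if_neg hμ.symm, ← Finset.natCast_card_filter, add_zero] at hcμ
  rw [Nat.card_eq_fintype_card, Nat.card_eq_fintype_card, Fintype.card_subtype,
    Fintype.card_subtype]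
  exact_mod_cast sub_eq_zero.1 hcμ

theorem exists_equiv_of_hammingNorm_eq (hφ : ∀ e, φ e ≠ 0) (hχ : ∀ f, χ f ≠ 0)
    (h : ∀ x, hammingNorm (fun e => φ e x) = hammingNorm (fun f => χ f x)) :
    ∃ π : E ≃ F, ∀ e, χ (π e) = φ e := by
  have hfiber (μ : G →+ ZMod 2) : Nat.card {e // φ e = μ} = Nat.card {f // χ f = μ} := by
    by_cases hμ : μ = 0
    · simp [hμ, hφ, hχ]
    · exact card_fiber_eq_of_hammingNorm_eq h hμ
  exact ⟨.ofFiberEquiv fun μ => (Finite.card_eq.1 (hfiber μ)).some, fun e =>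
    Equiv.ofFiberEquiv_map _ e⟩

theorem exists_equiv_of_isometric {L : AddSubgroup (E → ℤ)} {L' : AddSubgroup (F → ℤ)}
    (hL : HasSmallRepresentativesModTwo L) (hL' : HasSmallRepresentativesModTwo L')
    (hE : ∀ e, coordModTwo L e ≠ 0) (hF : ∀ f, coordModTwo L' f ≠ 0) (h : Isometric L L') :
    ∃ π : E ≃ F, ∀ I : Set E, LinearIndepOn (ZMod 2) (coordModTwo L) I ↔
      LinearIndepOn (ZMod 2) (coordModTwo L') (π '' I) := by
  obtain ⟨ψ, hψ⟩ := h
  let pullback : (L' →+ ZMod 2) ≃+ (L →+ ZMod 2) := ψ.symm.addMonoidHomCongrLeft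
  have hpullback (f : F) : pullback (coordModTwo L' f) ≠ 0 := by
    rw [ne_eq, EmbeddingLike.map_eq_zero_iff]
    exact hF f
  obtain ⟨π, hπ⟩ := exists_equiv_of_hammingNorm_eq hE hpullback
    (hammingNorm_coordModTwo_eq_of_isometry hL hL' ψ fun x => hψ x x)
  refine ⟨π, fun I => ?_⟩
  rw [← linearIndepOn_equiv π, ← LinearMap.linearIndepOn_iff_of_injOn
    (pullback.toAddMonoidHom.toZModLinearMap 2) pullback.injective.injOn]
  exact iff_of_eq (congrArg (LinearIndepOn (ZMod 2) · I) (funext hπ).symm)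

end MacWilliams

section RowWalk

variable {m n R : Type*} [CommRing R] {A : Matrix m n R} {S : Set n} {i j k : m} {c : n} {l : ℕ}

/-- `RowWalk A S l i j` says that the rows `i` and `j` of `A` are joined by a walk of length `l` in
which any two consecutive rows have nonzero entries in a common column of `S`. -/
inductive RowWalk (A : Matrix m n R) (S : Set n) : ℕ → m → m → Prop
  | refl (i : m) : RowWalk A S 0 i i
  | cons {l : ℕ} {i j k : m} {c : n} (hc : c ∈ S) (hi : A i c ≠ 0) (hk : A k c ≠ 0)
      (h : RowWalk A S l k j) : RowWalk A S (l + 1) i j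

theorem RowWalk.schurComplement_or_exists (k : m) (c : n) (h : RowWalk A S l i j) :
    RowWalk (schurComplement A k c) S l i j ∨
      ∃ l' ≤ l, ∃ v, A v c ≠ 0 ∧ RowWalk A S l' v j := by
  induction h with
  | refl i => exact .inl (.refl i)
  | @cons l i j v c' hc' hi hv h ih =>
    by_cases hic : A i c = 0
    · by_cases hvc : A v c = 0
      · refine ih.imp (.cons hc' ?_ ?_) fun ⟨l', hl', h'⟩ => ⟨l', hl'.trans l.le_succ, h'⟩
        · rwa [schurComplement_apply_of_pivot_col_eq_zero hic]
        · rwa [schurComplement_apply_of_pivot_col_eq_zero hvc]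
      · exact .inr ⟨l, l.le_succ, v, hvc, h⟩
    · exact .inr ⟨l + 1, le_rfl, i, hic, .cons hc' hi hv h⟩

/- Pivoting at `A k c` deletes the row `k` from the walk, and a later row meeting the column `c` is
adjacent to `i` already. -/
theorem RowWalk.exists_shorter [NoZeroDivisors R] (hc : c ∈ S) (hi : A i c ≠ 0) (hk : A k c ≠ 0)
    (h : RowWalk A S (l + 1) k j) :
    ∃ l' < l + 2, RowWalk A S l' i j ∨ RowWalk (schurComplement A k c) S l' i j := by
  obtain _ | @⟨_, _, _, v, c', hc', hkc', hv, h⟩ := h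
  by_cases hic' : A i c' = 0
  · by_cases hvc : A v c = 0
    · rcases h.schurComplement_or_exists k c with h | ⟨l', hl', w, hw, h⟩
      · exact ⟨l + 1, by omega, .inr (.cons hc' (by simp [schurComplement, hic', hi, hk, hkc'])
          (by rwa [schurComplement_apply_of_pivot_col_eq_zero hvc]) h)⟩
      · exact ⟨l' + 1, by omega, .inl (.cons hc hi hw h)⟩
    · exact ⟨l + 1, by omega, .inl (.cons hc hi hvc h)⟩
  · exact ⟨l + 1, by omega, .inl (.cons hc' hic' hv h)⟩

end RowWalk

section Signing

variable {m n : Type*} {A A' : Matrix m n ℤ} {S : Set n} {e : n}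

theorem apply_mul_apply_eq_of_isTotallyUnimodular (hA : A.IsTotallyUnimodular) {i k : m} {c d : n}
    (hic : A i c ≠ 0) (hid : A i d ≠ 0) (hkc : A k c ≠ 0) (hkd : A k d ≠ 0) :
    A i c * A k d = A i d * A k c := by
  have hminor := mem_range_signCast_iff.1 ((isTotallyUnimodular_iff A).1 hA 2 ![i, k] ![c, d])
  simp only [det_fin_two, submatrix_apply, cons_val_zero, cons_val_one] at hminor
  have hsign (i : m) (c : n) (h : A i c ≠ 0) : A i c = 1 ∨ A i c = -1 :=
    (mem_range_signCast_iff.1 (hA.apply i c)).resolve_left h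
  rcases hsign i c hic with h₁ | h₁ <;> rcases hsign i d hid with h₂ | h₂ <;>
    rcases hsign k c hkc with h₃ | h₃ <;> rcases hsign k d hkd with h₄ | h₄ <;>
    simp_all

theorem eq_or_eq_neg_of_isTotallyUnimodular (hA : A.IsTotallyUnimodular)
    (hA' : A'.IsTotallyUnimodular) {i : m} (h : A i e = 0 ↔ A' i e = 0) :
    A' i e = A i e ∨ A' i e = -A i e := by
  have := mem_range_signCast_iff.1 (hA.apply i e)
  have := mem_range_signCast_iff.1 (hA'.apply i e)
  omega

/-- Two totally unimodular matrices that agree in the columns `S` and have the same support in the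
column `e`: the situation met when `A` is adjusted to `A'` one column at a time. -/
structure IsSigningPair (A A' : Matrix m n ℤ) (S : Set n) (e : n) : Prop where
  left : A.IsTotallyUnimodular
  right : A'.IsTotallyUnimodular
  eq_on : ∀ i, ∀ c ∈ S, A i c = A' i c
  eq_zero_iff : ∀ i, A i e = 0 ↔ A' i e = 0

theorem IsSigningPair.pivot (h : IsSigningPair A A' S e) {k : m} {c : n} (hc : c ∈ S)
    (hkc : A k c ≠ 0) (hke : A k e = 0) :
    IsSigningPair (schurComplement A k c) (schurComplement A' k c) S e where
  left := isTotallyUnimodular_schurComplement h.left hkc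
  right := isTotallyUnimodular_schurComplement h.right (h.eq_on k c hc ▸ hkc)
  eq_on i d hd := by simp only [schurComplement, of_apply, h.eq_on _ _ hc, h.eq_on _ _ hd]
  eq_zero_iff i := by
    rw [schurComplement_apply_of_pivot_row_eq_zero hke,
      schurComplement_apply_of_pivot_row_eq_zero ((h.eq_zero_iff k).1 hke), h.eq_zero_iff i]

/- If the row `k` following `i` vanishes in the column `e`, the walk can be shortened, possibly
after a pivot; otherwise the `2 × 2` minors in the rows `i` and `k` compare the ratios
`A' i e / A i e`. -/
theorem IsSigningPair.mul_eq_mul_of_rowWalk (h : IsSigningPair A A' S e) {l : ℕ} {i j : m}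
    (hw : RowWalk A S l i j) (hi : A i e ≠ 0) (hj : A j e ≠ 0) :
    A' i e * A j e = A i e * A' j e := by
  induction l using Nat.strong_induction_on generalizing A A' i with
  | _ l ih =>
  obtain _ | @⟨l, _, _, k, c, hc, hic, hkc, hw⟩ := hw
  · exact mul_comm _ _
  by_cases hk : A k e = 0
  · obtain _ | l := l
    · obtain ⟨⟩ := hw
      exact absurd hk hj
    obtain ⟨l', hl', hw | hw⟩ := hw.exists_shorter hc hic hkc
    · exact ih l' hl' h hw hi hj
    · have hpivot (v : m) : schurComplement A k c v e = A v e :=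
        schurComplement_apply_of_pivot_row_eq_zero hk v
      have hpivot' (v : m) : schurComplement A' k c v e = A' v e :=
        schurComplement_apply_of_pivot_row_eq_zero ((h.eq_zero_iff k).1 hk) v
      simpa only [hpivot, hpivot'] using
        ih l' hl' (h.pivot hc hkc hk) hw (by rwa [hpivot]) (by rwa [hpivot])
  · have hkj := ih l l.lt_succ_self h hw hk hj
    have hik := apply_mul_apply_eq_of_isTotallyUnimodular h.left hic hi hkc hk
    have hik' := apply_mul_apply_eq_of_isTotallyUnimodular h.right (h.eq_on i c hc ▸ hic)
      ((h.eq_zero_iff i).not.1 hi) (h.eq_on k c hc ▸ hkc) ((h.eq_zero_iff k).not.1 hk)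
    rw [← h.eq_on i c hc, ← h.eq_on k c hc] at hik'
    refine mul_left_cancel₀ hkc ?_
    linear_combination A i c * hkj + A' j e * hik - A j e * hik'

theorem IsSigningPair.exists_row_signs (h : IsSigningPair A A' S e) :
    ∃ τ : m → ℤˣ, (∀ i, A' i e = τ i * A i e) ∧
      ∀ c ∈ S, ∀ i k, A i c ≠ 0 → A k c ≠ 0 → τ i = τ k := by
  classical
  let IsFlipped (i : m) : Prop := ∃ l j, RowWalk A S l i j ∧ A' j e ≠ A j e
  refine ⟨fun i => if IsFlipped i then -1 else 1, fun i => ?_, fun c hc i k hi hk => ?_⟩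
  · beta_reduce
    by_cases hi : A i e = 0
    · rw [hi, (h.eq_zero_iff i).1 hi, mul_zero]
    by_cases heq : A' i e = A i e
    · rw [if_neg, Units.val_one, one_mul, heq]
      rintro ⟨l, j, hw, hj⟩
      by_cases hj0 : A j e = 0
      · exact hj (((h.eq_zero_iff j).1 hj0).trans hj0.symm)
      have hratio := h.mul_eq_mul_of_rowWalk hw hi hj0
      rw [heq] at hratio
      exact hj (mul_left_cancel₀ hi hratio).symm
    · rw [if_pos ⟨0, i, .refl i, heq⟩, Units.val_neg, Units.val_one, neg_one_mul]
      exact (eq_or_eq_neg_of_isTotallyUnimodular h.left h.right (h.eq_zero_iff i)).resolve_left heq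
  · have hiff : IsFlipped i ↔ IsFlipped k :=
      ⟨fun ⟨l, j, hw, hj⟩ => ⟨l + 1, j, .cons hc hk hi hw, hj⟩,
        fun ⟨l, j, hw, hj⟩ => ⟨l + 1, j, .cons hc hi hk hw, hj⟩⟩
    simp only [hiff]

theorem IsSigningPair.exists_signing (h : IsSigningPair A A' S e) (he : e ∉ S) :
    ∃ (ρ : m → ℤˣ) (σ : n → ℤˣ), ∀ i, ∀ c ∈ insert e S, A' i c = ρ i * σ c * A i c := by
  obtain ⟨ρ, hρe, hρS⟩ := h.exists_row_signs
  have hσ (c : n) : ∃ s : ℤˣ, (c = e → s = 1) ∧ (c ∈ S → ∀ i, A i c ≠ 0 → s = ρ i) := by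
    by_cases hc : c ∈ S ∧ ∃ i, A i c ≠ 0
    · obtain ⟨hc, i, hi⟩ := hc
      exact ⟨ρ i, fun hce => absurd (hce ▸ hc) he, fun _ k hk => hρS c hc i k hi hk⟩
    · exact ⟨1, fun _ => rfl, fun hcS i hi => absurd ⟨hcS, i, hi⟩ hc⟩
  choose σ hσe hσS using hσ
  refine ⟨ρ, σ, fun i c hc => ?_⟩
  rcases hc with rfl | hc
  · rw [hσe c rfl, Units.val_one, mul_one, hρe]
  · by_cases hi : A i c = 0
    · rw [← h.eq_on i c hc, hi, mul_zero]
    · rw [hσS c hc i hi, ← Units.val_mul, Int.units_mul_self, Units.val_one, one_mul,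
        h.eq_on i c hc]

theorem unit_mem_range_signCast (u : ℤˣ) :
    (u : ℤ) ∈ Set.range (SignType.cast : SignType → ℤ) := by
  rcases Int.units_eq_one_or u with rfl | rfl
  exacts [⟨1, rfl⟩, ⟨-1, rfl⟩]

theorem exists_signing [Finite n] (hA : A.IsTotallyUnimodular) (hA' : A'.IsTotallyUnimodular)
    (hzero : ∀ i c, A i c = 0 ↔ A' i c = 0) :
    ∃ (ρ : m → ℤˣ) (σ : n → ℤˣ), ∀ i c, A' i c = ρ i * σ c * A i c := by
  suffices ∀ S : Set n, ∃ (ρ : m → ℤˣ) (σ : n → ℤˣ), ∀ i, ∀ c ∈ S, A' i c = ρ i * σ c * A i c by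
    simpa using this Set.univ
  intro S
  induction S, S.toFinite using Set.Finite.induction_on with
  | empty => exact ⟨1, 1, by simp⟩
  | @insert e S he _ ih =>
    obtain ⟨ρ, σ, h⟩ := ih
    have hpair : IsSigningPair (of fun i c => (ρ i * σ c : ℤ) * A i c) A' S e :=
      { left := isTotallyUnimodular_sign_mul hA (fun i => unit_mem_range_signCast (ρ i))
          fun c => unit_mem_range_signCast (σ c)
        right := hA'
        eq_on := fun i c hc => (h i c hc).symm
        eq_zero_iff := fun i => by simp [hzero] }
    obtain ⟨ρ', σ', h'⟩ := hpair.exists_signing he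
    refine ⟨ρ' * ρ, σ' * σ, fun i c hc => (h' i c hc).trans ?_⟩
    simp only [of_apply, Pi.mul_apply, Units.val_mul]
    ring

end Signing

section ColumnMatroid

theorem isColumnBasis_iff_injective_and_linearIndepOn {m n K : Type*} [Field K] [Fintype m]
    [DecidableEq m] {A : Matrix m n K} {b : m → n} :
    IsColumnBasis A b ↔ b.Injective ∧ LinearIndepOn K A.col (Set.range b) := by
  rw [isColumnBasis_iff_linearIndependent]
  refine ⟨fun h => ?_, fun ⟨hinj, h⟩ => (linearIndepOn_range_iff hinj _).1 h⟩
  have hinj : b.Injective := h.injective.of_comp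
  exact ⟨hinj, (linearIndepOn_range_iff hinj _).2 h⟩

theorem card_le_card_of_linearIndepOn_col {m m' n K : Type*} [Field K] [Fintype m]
    [DecidableEq m] [Fintype m'] {A : Matrix m n K} {B : Matrix m' n K} {b : m → n}
    (hb : IsColumnBasis A b)
    (h : ∀ I : Set n, LinearIndepOn K A.col I → LinearIndepOn K B.col I) :
    Fintype.card m ≤ Fintype.card m' := by
  obtain ⟨hinj, hb⟩ := isColumnBasis_iff_injective_and_linearIndepOn.1 hb
  simpa using ((linearIndepOn_range_iff hinj _).1 (h _ hb)).fintype_card_le_finrank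

variable {E F : Type*} [Fintype E] [Fintype F] {r s : ℕ}

theorem isometric_cutLattice_of_isColumnBasis_iff {A B : Matrix (Fin r) E ℤ} {b : Fin r → E}
    (hA : A.IsTotallyUnimodular) (hB : B.IsTotallyUnimodular) (hb : IsColumnBasis A b)
    (h : ∀ g : Fin r → E, IsColumnBasis A g ↔ IsColumnBasis B g) :
    Isometric (cutLattice A) (cutLattice B) := by
  have hb' : IsColumnBasis B b := (h b).1 hb
  have hA' := isTotallyUnimodular_standardForm hA hb
  have hB' := isTotallyUnimodular_standardForm hB hb'
  have hzero (i : Fin r) (e : E) : standardForm A b i e = 0 ↔ standardForm B b i e = 0 := by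
    rw [← not_iff_not, ← ne_eq, ← ne_eq,
      ← isUnit_iff_ne_zero_of_mem_range_signCast (hA'.apply i e),
      ← isUnit_iff_ne_zero_of_mem_range_signCast (hB'.apply i e),
      isUnit_standardForm_apply_iff hb, isUnit_standardForm_apply_iff hb', h]
  obtain ⟨ρ, σ, hsign⟩ := exists_signing hA' hB' hzero
  have hisometric := isometric_cutLattice_sign_mul (standardForm A b) ρ σ
  rwa [show of (fun i e => (ρ i * σ e : ℤ) * standardForm A b i e) = standardForm B b from
    ext fun i e => (hsign i e).symm, cutLattice_standardForm hb,
    cutLattice_standardForm hb'] at hisometric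

theorem isometric_cutLattice_of_linearIndepOn_iff {A : Matrix (Fin r) E ℤ}
    {B : Matrix (Fin s) F ℤ} {b : Fin r → E} {b' : Fin s → F} (hA : A.IsTotallyUnimodular)
    (hB : B.IsTotallyUnimodular) (hb : IsColumnBasis A b) (hb' : IsColumnBasis B b') (e : E ≃ F)
    (he : ∀ I, LinearIndepOn ℝ (A.map (Int.cast : ℤ → ℝ)).col I ↔
      LinearIndepOn ℝ (B.map (Int.cast : ℤ → ℝ)).col (e '' I)) :
    Isometric (cutLattice A) (cutLattice B) := by
  let B' : Matrix (Fin s) E ℤ := B.submatrix id e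
  have hB' : B'.IsTotallyUnimodular := hB.submatrix id e
  have hbB' : IsColumnBasis B' (e.symm ∘ b') := by
    simpa [IsColumnBasis, B', Function.comp_assoc, ← Function.comp_assoc e] using hb'
  have hcol (I : Set E) : LinearIndepOn ℝ (A.map (Int.cast : ℤ → ℝ)).col I ↔
      LinearIndepOn ℝ (B'.map (Int.cast : ℤ → ℝ)).col I :=
    (he I).trans (linearIndepOn_equiv e).symm
  obtain rfl : r = s := by
    refine le_antisymm ?_ ?_
    · simpa using card_le_card_of_linearIndepOn_col
        ((isColumnBasis_map_intCast_iff hA).2 hb) fun I => (hcol I).1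
    · simpa using card_le_card_of_linearIndepOn_col
        ((isColumnBasis_map_intCast_iff hB').2 hbB') fun I => (hcol I).2
  have hbasis (g : Fin r → E) : IsColumnBasis A g ↔ IsColumnBasis B' g := by
    rw [← isColumnBasis_map_intCast_iff (R := ℝ) hA, ← isColumnBasis_map_intCast_iff (R := ℝ) hB',
      isColumnBasis_iff_injective_and_linearIndepOn,
      isColumnBasis_iff_injective_and_linearIndepOn, hcol]
  refine (isometric_cutLattice_of_isColumnBasis_iff hA hB' hb hbasis).trans ?_
  exact (isometric_cutLattice_submatrix e.injective fun f hf => absurd (e.surjective f) hf).symm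

end ColumnMatroid

section Representation

variable {α β : Type*} {M : Matroid α} {N : Matroid β} [Fintype M.E] [Fintype N.E] {r s : ℕ}
  {A : Matrix (Fin r) M.E ℤ} {B : Matrix (Fin s) N.E ℤ}

theorem IsTURepresentation.exists_isColumnBasis (hA : IsTURepresentation M A) :
    ∃ b, IsColumnBasis A b := by
  have hrow : LinearIndependent ℝ (A.map (Int.cast : ℤ → ℝ)).row := by
    rw [linearIndependent_iff_card_eq_finrank_span, Set.finrank, ← rank_eq_finrank_span_row,
      hA.rank_eq, Fintype.card_fin]
  obtain ⟨b, hb⟩ := RegularMatroid.exists_isColumnBasis hrow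
  exact ⟨b, (isColumnBasis_map_intCast_iff hA.totallyUnimodular).1 hb⟩

theorem IsTURepresentation.isNonloop_iff (hA : IsTURepresentation M A) (e : M.E) :
    M.IsNonloop e ↔ LinearIndepOn ℝ (A.map (Int.cast : ℤ → ℝ)).col {e} := by
  rw [← hA.indep_iff, Set.image_singleton, Matroid.indep_singleton]

theorem IsTURepresentation.coordModTwo_ne_zero [M.Loopless] (hA : IsTURepresentation M A)
    (e : M.E) : coordModTwo (cutLattice A) e ≠ 0 := by
  obtain ⟨b, hb⟩ := hA.exists_isColumnBasis
  rw [← linearIndepOn_singleton_iff (ZMod 2),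
    linearIndepOn_coordModTwo_cutLattice_iff hA.totallyUnimodular hb, ← hA.isNonloop_iff]
  exact Matroid.isNonloop_of_loopless e.2

theorem isomorphic_of_isometric [M.Loopless] [N.Loopless] (hA : IsTURepresentation M A)
    (hB : IsTURepresentation N B) (h : Isometric (cutLattice A) (cutLattice B)) :
    Isomorphic M N := by
  obtain ⟨b, hb⟩ := hA.exists_isColumnBasis
  obtain ⟨b', hb'⟩ := hB.exists_isColumnBasis
  obtain ⟨π, hπ⟩ := exists_equiv_of_isometric
    (hasSmallRepresentativesModTwo_cutLattice hA.totallyUnimodular hb)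
    (hasSmallRepresentativesModTwo_cutLattice hB.totallyUnimodular hb')
    hA.coordModTwo_ne_zero hB.coordModTwo_ne_zero h
  refine ⟨π, fun I => ?_⟩
  rw [hA.indep_iff, hB.indep_iff,
    ← linearIndepOn_coordModTwo_cutLattice_iff hA.totallyUnimodular hb, hπ,
    linearIndepOn_coordModTwo_cutLattice_iff hB.totallyUnimodular hb']

theorem isometric_of_isomorphic (hA : IsTURepresentation M A) (hB : IsTURepresentation N B)
    (h : Isomorphic M N) : Isometric (cutLattice A) (cutLattice B) := by
  obtain ⟨b, hb⟩ := hA.exists_isColumnBasis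
  obtain ⟨b', hb'⟩ := hB.exists_isColumnBasis
  obtain ⟨e, he⟩ := h
  refine isometric_cutLattice_of_linearIndepOn_iff hA.totallyUnimodular hB.totallyUnimodular
    hb hb' e fun I => ?_
  rw [← hA.indep_iff, ← hB.indep_iff, he]

end Representation

section Loops

variable {α : Type*} {M : Matroid α}

instance loopless_deleteLoops (M : Matroid α) : (deleteLoops M).Loopless :=
  Matroid.loopless_iff_forall_not_isLoop.2 fun _ _ he => (Matroid.delete_isLoop_iff.1 he).2
    (Matroid.delete_isLoop_iff.1 he).1

/-- The inclusion of the ground set of `M°` into that of `M`, both regarded as types. -/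
def deleteLoopsInclusion (M : Matroid α) : (deleteLoops M).E → M.E :=
  fun e => ⟨e, e.2.1⟩

theorem deleteLoopsInclusion_injective : (deleteLoopsInclusion M).Injective :=
  fun _ _ h => Subtype.ext (congrArg (Subtype.val : M.E → α) h)

instance finite_ground_deleteLoops [Finite M.E] : Finite (deleteLoops M).E :=
  .of_injective _ deleteLoopsInclusion_injective

theorem deleteLoops_indep_iff (I : Set (deleteLoops M).E) :
    (deleteLoops M).Indep (Subtype.val '' I) ↔
      M.Indep (Subtype.val '' (deleteLoopsInclusion M '' I)) := by
  have hdisjoint : Disjoint (Subtype.val '' I) M.loops := by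
    rw [Set.disjoint_left]
    rintro _ ⟨e, -, rfl⟩
    exact e.2.2
  rw [Set.image_image]
  exact Matroid.delete_indep_iff.trans (and_iff_left hdisjoint)

variable [Fintype M.E] {r : ℕ} {A : Matrix (Fin r) M.E ℤ}

theorem IsTURepresentation.col_eq_zero_of_notMem_range (hA : IsTURepresentation M A) {e : M.E}
    (he : e ∉ Set.range (deleteLoopsInclusion M)) : A.col e = 0 := by
  have hloop : ¬ M.IsNonloop e := fun h => he ⟨⟨e, e.2, h.not_isLoop⟩, rfl⟩
  rw [hA.isNonloop_iff, linearIndepOn_singleton_iff, not_not] at hloop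
  exact funext fun i => Int.cast_injective ((congrFun hloop i).trans Int.cast_zero.symm)

theorem IsTURepresentation.exists_isColumnBasis_deleteLoops (hA : IsTURepresentation M A) :
    ∃ b, IsColumnBasis (A.submatrix id (deleteLoopsInclusion M)) b := by
  obtain ⟨b, hb⟩ := hA.exists_isColumnBasis
  have hmem (i : Fin r) : b i ∈ Set.range (deleteLoopsInclusion M) := by
    by_contra hi
    exact hb.ne_zero (det_eq_zero_of_column_eq_zero i
      fun j => congrFun (hA.col_eq_zero_of_notMem_range hi) j)
  choose b' hb' using hmem
  obtain rfl : deleteLoopsInclusion M ∘ b' = b := funext hb'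
  exact ⟨b', hb⟩

variable [Fintype (deleteLoops M).E]

theorem IsTURepresentation.submatrix_deleteLoopsInclusion (hA : IsTURepresentation M A) :
    IsTURepresentation (deleteLoops M) (A.submatrix id (deleteLoopsInclusion M)) where
  totallyUnimodular := hA.totallyUnimodular.submatrix id _
  rank_eq := by
    obtain ⟨b, hb⟩ := hA.exists_isColumnBasis_deleteLoops
    have hbasis := (isColumnBasis_map_intCast_iff (R := ℝ)
      (hA.totallyUnimodular.submatrix id _)).2 hb
    rw [(linearIndependent_row_of_isColumnBasis hbasis).rank_matrix, Fintype.card_fin]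
  indep_iff I := by
    rw [deleteLoops_indep_iff, hA.indep_iff]
    exact ⟨fun h => h.comp_of_image deleteLoopsInclusion_injective.injOn,
      fun h => .image_of_comp (deleteLoopsInclusion M) (A.map (Int.cast : ℤ → ℝ)).col h⟩

theorem IsTURepresentation.isometric_cutLattice_deleteLoops (hA : IsTURepresentation M A) :
    Isometric (cutLattice A) (cutLattice (A.submatrix id (deleteLoopsInclusion M))) :=
  isometric_cutLattice_submatrix deleteLoopsInclusion_injective
    fun _ => hA.col_eq_zero_of_notMem_range

end Loops

end RegularMatroid

theorem mainTheorem8 {α : Type*} {β : Type*} (M : Matroid α) (N : Matroid β)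
    [Fintype M.E] [Fintype N.E]
    (hM : RegularMatroid.IsRegular M) (hN : RegularMatroid.IsRegular N) :
    ∀ {r s : ℕ} (A : Matrix (Fin r) M.E ℤ) (B : Matrix (Fin s) N.E ℤ),
      RegularMatroid.IsTURepresentation M A → RegularMatroid.IsTURepresentation N B →
      (RegularMatroid.Isometric (RegularMatroid.cutLattice A) (RegularMatroid.cutLattice B) ↔
        RegularMatroid.Isomorphic (RegularMatroid.deleteLoops M)
          (RegularMatroid.deleteLoops N)) := by
  intro r s A B hA hB
  cases nonempty_fintype (RegularMatroid.deleteLoops M).E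
  cases nonempty_fintype (RegularMatroid.deleteLoops N).E
  have hA' := hA.submatrix_deleteLoopsInclusion
  have hB' := hB.submatrix_deleteLoopsInclusion
  have hM' := hA.isometric_cutLattice_deleteLoops
  have hN' := hB.isometric_cutLattice_deleteLoops
  constructor
  · intro h
    exact RegularMatroid.isomorphic_of_isometric hA' hB' (hM'.symm.trans (h.trans hN'))
  · intro h
    exact hM'.trans ((RegularMatroid.isometric_of_isomorphic hA' hB' h).trans hN'.symm)
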